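/- All Banach spaces are complex. A Banach couple $\vec X=(X_0,X_1)$ consists of two Banach spaces continuously embedded in a common Hausdorff topological vector space; an operator $T\colon\vec X\to\vec Y$ is a linear map $X_0+X_1\to Y_0+Y_1$ whose restrictions $X_j\to Y_j$ $(j=0,1)$ are defined and bounded. An interpolation functor $\mathcal F$ assigns to every Banach couple $\vec X$ a Banach space $\mathcal F(\vec X)$ with $X_0\cap X_1\subset\mathcal F(\vec X)\subset X_0+X_1$ (continuously) such that every operator $T\colon\vec X\to\vec Y$ restricts to a bounded operator $\mathcal F(\vec X)\to\mathcal F(\vec Y)$. It is exact if always $\|T\colon\mathcal F(\vec X)\to\mathcal F(\vec Y)\|\le\max\{\|T\colon X_0\to Y_0\|,\|T\colon X_1\to Y_1\|\}$. Its fundamental function is $$\psi_{\mathcal F}(s,t)=\sup\{\|T\colon\mathcal F(\vec X)\to\mathcal F(\vec Y)\| : \|T\colon X_0\to Y_0\|\le s,\ \|T\colon X_1\to Y_1\|\le t\},\qquad s,t>0,$$ the supremum being over all Banach couples $\vec X,\vec Y$ and operators $T\colon\vec X\to\vec Y$. For $m,n\in\mathbb N=\{1,2,\dots\}$ let $\Lambda^{\le}(m,n)$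 be the set of all $\alpha\in\mathbb N_0^n$ with $\alpha_1+\dots+\alpha_n\le m$, and let $\mathcal P_{\le m}(\mathbb T^n)$ be the space of polynomials $f(z)=\sum_{\alpha\in\Lambda^{\le}(m,n)}c_\alpha z^\alpha$ on the torus $\mathbb T^n$ with the supremum norm. For $\xi=(\xi_\alpha)\in\mathbb C^{\Lambda^{\le}(m,n)}$ let $M_\xi\colon\mathcal P_{\le m}(\mathbb T^n)\to\ell_1(\Lambda^{\le}(m,n))$, $M_\xi f=(\xi_\alpha\hat f(\alpha))_\alpha$, where $\hat f(\alpha)$ is the Fourier coefficient. **Theorem.** Let $\mathcal F$ be an exact interpolation functor, normalized by $\|1\|_{\mathcal F(\mathbb C,\mathbb C)}\le1$. Let $m,n\in\mathbb N$ and $$X=\mathcal F\big(\ell_1(\Lambda^{\le}(m,n)),\,\ell_{2m/(m+1)}(\Lambda^{\le}(m,n))\big).$$ Then for every $\xi\in\mathbb C^{\Lambda^{\le}(m,n)}$ $$\sup_{\|\mu\|_{\ell_2(\Lambda^{\le}(m,n))}\le1}\|(\xi_\alpha\mu_\alpha)_{\alpha}\|_X\le C(m)\,\sqrt n\,\big\|M_\xi\colon\mathcal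 P_{\le m}(\mathbb T^n)\to\ell_1(\Lambda^{\le}(m,n))\big\|,$$ where $C(m)=2\sqrt2\,e^2\,\psi_{\mathcal F}(1,1)\,\psi_{\mathcal F}\big(\sqrt{\log(1+20m)},1\big)$. -/

import Mathlib

open scoped ENNReal
open MeasureTheory

noncomputable section

namespace KislyakovInterpolation

/-! ### Banach couples and interpolation functors -/

/-- A complex Banach space continuously (and linearly) embedded in the topological vector space
`V`; the vectors of `V` that belong to the space are those in the range of `ι`. -/
structure BanachIn (V : Type) [AddCommGroup V] [Module ℂ V] [TopologicalSpace V] where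
  E : Type
  [normedAddCommGroup : NormedAddCommGroup E]
  [normedSpace : NormedSpace ℂ E]
  [completeSpace : CompleteSpace E]
  ι : E →L[ℂ] V
  injective : Function.Injective ι

attribute [instance] BanachIn.normedAddCommGroup BanachIn.normedSpace BanachIn.completeSpace

section

variable {V : Type} [AddCommGroup V] [Module ℂ V] [TopologicalSpace V]

/-- The linear subspace of `V` underlying an embedded Banach space. -/
def BanachIn.subspace (Z : BanachIn V) : Submodule ℂ V := LinearMap.range Z.ι.toLinearMap

/-- The norm `‖v‖_Z` of `v : V` in the embedded Banach space `Z`, with value `∞` if `v` does not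
belong to `Z`. (There is at most one `x` with `Z.ι x = v`.) -/
def BanachIn.nrm (Z : BanachIn V) (v : V) : ℝ≥0∞ := ⨅ (x : Z.E) (_ : Z.ι x = v), ‖x‖ₑ

end

/-- A Banach couple: two complex Banach spaces continuously embedded in a common Hausdorff
topological vector space `V`. -/
structure BanachCouple where
  V : Type
  [addCommGroup : AddCommGroup V]
  [module : Module ℂ V]
  [topologicalSpace : TopologicalSpace V]
  [isTopologicalAddGroup : IsTopologicalAddGroup V]
  [continuousSMul : ContinuousSMul ℂ V]
  [t2Space : T2Space V]
  X₀ : BanachIn V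
  X₁ : BanachIn V

attribute [instance] BanachCouple.addCommGroup BanachCouple.module BanachCouple.topologicalSpace
  BanachCouple.isTopologicalAddGroup BanachCouple.continuousSMul BanachCouple.t2Space

/-- `X₀ + X₁`. -/
def BanachCouple.sum (X : BanachCouple) : Submodule ℂ X.V := X.X₀.subspace ⊔ X.X₁.subspace

/-- `X₀ ∩ X₁`. -/
def BanachCouple.inter (X : BanachCouple) : Submodule ℂ X.V := X.X₀.subspace ⊓ X.X₁.subspace

/-- An operator `T : (X₀, X₁) → (Y₀, Y₁)` between Banach couples: a linear map
`X₀ + X₁ → Y₀ + Y₁` whose restrictions are bounded operators `T₀ : X₀ → Y₀`, `T₁ : X₁ → Y₁`. -/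
structure CoupleHom (X Y : BanachCouple) where
  T : X.sum →ₗ[ℂ] Y.sum
  T₀ : X.X₀.E →L[ℂ] Y.X₀.E
  T₁ : X.X₁.E →L[ℂ] Y.X₁.E
  restrict₀ : ∀ (x : X.X₀.E) (v : X.sum), (v : X.V) = X.X₀.ι x → (T v : Y.V) = Y.X₀.ι (T₀ x)
  restrict₁ : ∀ (x : X.X₁.E) (v : X.sum), (v : X.V) = X.X₁.ι x → (T v : Y.V) = Y.X₁.ι (T₁ x)

/-- The norm `max {‖T : X₀ → Y₀‖, ‖T : X₁ → Y₁‖}` of an operator between Banach couples. -/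
def CoupleHom.norm {X Y : BanachCouple} (T : CoupleHom X Y) : ℝ := max ‖T.T₀‖ ‖T.T₁‖

/-- An interpolation functor: it assigns to every Banach couple an intermediate Banach space, and
every operator `T` between couples restricts to a bounded operator `map T` between the assigned
spaces (which is uniquely determined by `map_spec`). -/
structure InterpolationFunctor where
  obj : (X : BanachCouple) → BanachIn X.V
  inter_le : ∀ X : BanachCouple, X.inter ≤ (obj X).subspace
  le_sum : ∀ X : BanachCouple, (obj X).subspace ≤ X.sum
  map : {X Y : BanachCouple} → CoupleHom X Y → (obj X).E →L[ℂ] (obj Y).E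
  map_spec : ∀ {X Y : BanachCouple} (T : CoupleHom X Y) (x : (obj X).E) (v : X.sum),
    (v : X.V) = (obj X).ι x → (T.T v : Y.V) = (obj Y).ι (map T x)

/-- Exactness: `‖T : 𝓕(X) → 𝓕(Y)‖ ≤ max {‖T : X₀ → Y₀‖, ‖T : X₁ → Y₁‖}`. -/
def InterpolationFunctor.IsExact (F : InterpolationFunctor) : Prop :=
  ∀ (X Y : BanachCouple) (T : CoupleHom X Y), ‖F.map T‖ ≤ T.norm

/-- The fundamental function `ψ_𝓕(s, t)`: the supremum of `‖T : 𝓕(X) → 𝓕(Y)‖` over all operators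
with `‖T : X₀ → Y₀‖ ≤ s` and `‖T : X₁ → Y₁‖ ≤ t` (bounded by `max s t` if `𝓕` is exact). -/
def InterpolationFunctor.fundamentalFunction (F : InterpolationFunctor) (s t : ℝ) : ℝ :=
  sSup {r : ℝ | ∃ (X Y : BanachCouple) (T : CoupleHom X Y), ‖T.T₀‖ ≤ s ∧ ‖T.T₁‖ ≤ t ∧
    r = ‖F.map T‖}

/-- The scalar field `ℂ` as a Banach space in itself. -/
def scalarBanach : BanachIn ℂ where
  E := ℂ
  ι := ContinuousLinearMap.id ℂ ℂ
  injective := Function.injective_id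

/-- The couple `(ℂ, ℂ)`. -/
def scalarCouple : BanachCouple where
  V := ℂ
  X₀ := scalarBanach
  X₁ := scalarBanach

/-- The normalization `‖1‖_{𝓕(ℂ, ℂ)} ≤ 1`. -/
def InterpolationFunctor.IsNormalized (F : InterpolationFunctor) : Prop :=
  (F.obj scalarCouple).nrm (1 : ℂ) ≤ 1

/-! ### The spaces `ℓ_p(Λ)` -/

/-- `ℓ_p(Λ)` as a Banach space inside `ℂ^Λ`. -/
def ellp (Λ : Type) [Fintype Λ] (p : ℝ≥0∞) [Fact (1 ≤ p)] : BanachIn (Λ → ℂ) where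
  E := PiLp p (fun _ : Λ => ℂ)
  ι := (PiLp.continuousLinearEquiv p ℂ (fun _ : Λ => ℂ)).toContinuousLinearMap
  injective := (PiLp.continuousLinearEquiv p ℂ (fun _ : Λ => ℂ)).injective

/-- The multi-indices `α = (α₁, …, αₙ)` of nonnegative integers with `∑ αⱼ ≤ m`. -/
abbrev MultiIndex (m n : ℕ) : Type := {α : Fin n → ℕ // ∑ j, α j ≤ m}

instance (m n : ℕ) : Finite (MultiIndex m n) := by
  refine Set.Finite.subset (Set.finite_Iic (fun _ : Fin n => m)) ?_
  intro α hα j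
  exact (Finset.single_le_sum (f := α) (fun _ _ => Nat.zero_le _) (Finset.mem_univ j)).trans hα

instance (m n : ℕ) : Fintype (MultiIndex m n) := Fintype.ofFinite _

/-- The exponent `2m/(m+1)`. -/
def bhExponent (m : ℕ) : ℝ≥0∞ := ENNReal.ofReal (2 * m / (m + 1))

theorem one_le_bhExponent {m : ℕ} (hm : 1 ≤ m) : 1 ≤ bhExponent m := by
  have h : (1 : ℝ) ≤ m := by exact_mod_cast hm
  rw [bhExponent, ENNReal.one_le_ofReal, le_div_iff₀ (by positivity)]
  linarith

/-- The couple `(ℓ_1, ℓ_{2m/(m+1)})` over the multi-indices of order at most `m` and length `n`. -/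
def ellCouple (m n : ℕ) (hm : 1 ≤ m) : BanachCouple where
  V := MultiIndex m n → ℂ
  X₀ := ellp (MultiIndex m n) 1
  X₁ :=
    haveI : Fact (1 ≤ bhExponent m) := ⟨one_le_bhExponent hm⟩
    ellp (MultiIndex m n) (bhExponent m)

/-! ### Analytic polynomials on the torus and multipliers

The torus `𝕋ⁿ` is `UnitAddTorus (Fin n) = (ℝ/ℤ)ⁿ`, where `zⱼ = exp (2πi xⱼ)`: the monomial `z^α` is
`UnitAddTorus.mFourier α`, and Fourier coefficients are taken with respect to Haar measure. -/

/-- A multi-index as a vector of integers, that is, as a character of the torus. -/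
def MultiIndex.toInt {m n : ℕ} (α : MultiIndex m n) : Fin n → ℤ := fun j => (α.1 j : ℤ)

/-- `𝓟_{≤ m}(𝕋ⁿ)`: the analytic polynomials of degree at most `m`, as a subspace of `C(𝕋ⁿ)` with the
supremum norm. -/
def polySpace (m n : ℕ) : Submodule ℂ C(UnitAddTorus (Fin n), ℂ) :=
  Submodule.span ℂ (Set.range fun α : MultiIndex m n => UnitAddTorus.mFourier α.toInt)

/-- `𝓟_{≤ m}(𝕋ⁿ)` as a normed space. -/
def PolySpace (m n : ℕ) : Type := polySpace m n

instance (m n : ℕ) : NormedAddCommGroup (PolySpace m n) :=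
  inferInstanceAs (NormedAddCommGroup (polySpace m n))

instance (m n : ℕ) : NormedSpace ℂ (PolySpace m n) :=
  inferInstanceAs (NormedSpace ℂ (polySpace m n))

instance (m n : ℕ) : FiniteDimensional ℂ (PolySpace m n) :=
  FiniteDimensional.span_of_finite ℂ (Set.finite_range _)

/-- A polynomial as a continuous function on the torus. -/
def PolySpace.toContinuousMap {m n : ℕ} (f : PolySpace m n) : C(UnitAddTorus (Fin n), ℂ) := f.1

theorem PolySpace.norm_eq {m n : ℕ} (f : PolySpace m n) : ‖f‖ = ‖f.toContinuousMap‖ := rfl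

theorem integrable_mFourier_smul {n : ℕ} (k : Fin n → ℤ) (f : C(UnitAddTorus (Fin n), ℂ)) :
    Integrable (fun t => UnitAddTorus.mFourier (-k) t • f t)
      (Measure.pi fun _ : Fin n => (AddCircle.haarAddCircle : Measure UnitAddCircle)) := by
  refine Continuous.integrable_of_hasCompactSupport ?_ (HasCompactSupport.of_compactSpace _)
  fun_prop

theorem mFourierCoeff_add {n : ℕ} (k : Fin n → ℤ) (f g : C(UnitAddTorus (Fin n), ℂ)) :
    UnitAddTorus.mFourierCoeff (fun t => (f + g) t) k
      = UnitAddTorus.mFourierCoeff f k + UnitAddTorus.mFourierCoeff g k := by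
  refine Eq.trans ?_ (integral_add (integrable_mFourier_smul k f) (integrable_mFourier_smul k g))
  simp only [UnitAddTorus.mFourierCoeff, ContinuousMap.add_apply, smul_add]

theorem mFourierCoeff_smul {n : ℕ} (k : Fin n → ℤ) (c : ℂ) (f : C(UnitAddTorus (Fin n), ℂ)) :
    UnitAddTorus.mFourierCoeff (fun t => (c • f) t) k = c * UnitAddTorus.mFourierCoeff f k := by
  unfold UnitAddTorus.mFourierCoeff
  rw [← integral_const_mul]
  simp only [ContinuousMap.smul_apply, smul_eq_mul, mul_left_comm]

/-- The multiplier `M_ξ : 𝓟_{≤ m}(𝕋ⁿ) → ℓ_1`, `f ↦ (ξ_α f^(α))_α`. -/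
def multiplier {m n : ℕ} (ξ : MultiIndex m n → ℂ) :
    PolySpace m n →L[ℂ] PiLp 1 (fun _ : MultiIndex m n => ℂ) :=
  LinearMap.toContinuousLinearMap
    { toFun := fun f => WithLp.toLp 1 fun α =>
        ξ α * UnitAddTorus.mFourierCoeff f.toContinuousMap α.toInt
      map_add' := by
        intro f g
        ext α
        change ξ α * _ = ξ α * _ + ξ α * _
        rw [← mul_add, ← mFourierCoeff_add]
        rfl
      map_smul' := by
        intro c f
        ext α
        change ξ α * _ = c * (ξ α * _)
        rw [mul_left_comm c, ← mFourierCoeff_smul _ c]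
        rfl }

end KislyakovInterpolation

end

open scoped ENNReal
open MeasureTheory

noncomputable section
namespace KislyakovInterpolation

/-! ### Counting multi-indices -/

/-! Fix `μ` in the unit ball of ℓ₂ and put v = (ξ_α μ_α), r = 2√2 e² √n ‖M_ξ‖. It suffices to bound
v in the two endpoint spaces: by r √(log(1+20m)) in ℓ₁ and by r in ℓ_{2m/(m+1)}. The rank-one
operator c ↦ c v/r on (ℂ, ℂ) then has endpoint norms at most √(log(1+20m)) and 1; applied to the
scalar 1, which has norm at most 1 in 𝓕(ℂ, ℂ), it gives ‖v‖_X ≤ r ψ(√(log(1+20m)), 1)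
(`nrm_le_of_norm_le`).

The ℓ₁ bound (`norm_diagonal_one_le`) tests M_ξ on a polynomial ∑ ε_α μ_α z^α with signs making its
supremum norm of order √(n log(1+20m)) (`exists_signs_norm_le`). Such signs exist because sign sums
have subgaussian moments, while the supremum norm and the L_{2k}-norm differ only by a constant
factor once k is about n log(1+20m).

For the other endpoint (`norm_diagonal_bhExponent_le`), monomials give |ξ_α| ≤ ‖M_ξ‖, and Hölder
from ℓ₂ to ℓ_{2m/(m+1)} costs |Λ|^{1/(2m)} ≤ √(2en). -/

theorem card_multiIndex_mul_pow_le (K n : ℕ) {x : ℝ} (hx0 : 0 ≤ x) (hx1 : x < 1) :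
    (Fintype.card (MultiIndex K n) : ℝ) * x ^ K ≤ ((1 - x)⁻¹) ^ n := by
  have hbound : ∀ α : MultiIndex K n, ∀ j, α.1 j ≤ K := fun α j =>
    (Finset.single_le_sum (f := α.1) (fun _ _ => Nat.zero_le _) (Finset.mem_univ j)).trans α.2
  calc (Fintype.card (MultiIndex K n) : ℝ) * x ^ K
      = ∑ _α : MultiIndex K n, x ^ K := by simp
    -- Generating-function bound: each multi-index has weight at least x^K, and the weights summed
    -- over the full cube factor into geometric sums.
    _ ≤ ∑ α : MultiIndex K n, ∏ j, x ^ α.1 j := by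
        refine Finset.sum_le_sum fun α _ => ?_
        rw [Finset.prod_pow_eq_pow_sum]
        exact pow_le_pow_of_le_one hx0 hx1.le α.2
    _ = ∑ β ∈ Finset.univ.map (Function.Embedding.subtype fun β : Fin n → ℕ => ∑ j, β j ≤ K),
          ∏ j, x ^ β j := by
        rw [Finset.sum_map]; rfl
    _ ≤ ∑ β ∈ Fintype.piFinset (fun _ : Fin n => Finset.range (K + 1)), ∏ j, x ^ β j := by
        refine Finset.sum_le_sum_of_subset_of_nonneg ?_ fun β _ _ => by positivity
        intro β hβ
        obtain ⟨α, -, rfl⟩ := Finset.mem_map.1 hβ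
        exact Fintype.mem_piFinset.2 fun j => Finset.mem_range_succ_iff.2 (hbound α j)
    _ = (∑ a ∈ Finset.range (K + 1), x ^ a) ^ n := by
        rw [← Finset.prod_univ_sum]; simp
    _ ≤ ((1 - x)⁻¹) ^ n := by
        refine pow_le_pow_left₀ (by positivity) ?_ n
        rw [← tsum_geometric_of_lt_one hx0 hx1]
        exact (summable_geometric_of_lt_one hx0 hx1).sum_le_tsum _ fun a _ => by positivity

/-- The value x = K/(K+n) minimizes x^{-K}(1-x)^{-n}. Either factor can then be absorbed into an
exponential, which gives an n-th power for the moment argument and a K-th power for taking m-th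
roots. -/
theorem card_multiIndex_le (K n : ℕ) (hK : 1 ≤ K) (hn : 1 ≤ n) :
    (Fintype.card (MultiIndex K n) : ℝ) ≤ (1 + n / K : ℝ) ^ K * (1 + K / n : ℝ) ^ n := by
  have hK' : (0 : ℝ) < K := by exact_mod_cast hK
  have hn' : (0 : ℝ) < n := by exact_mod_cast hn
  have h := card_multiIndex_mul_pow_le K n (x := K / (K + n)) (by positivity)
    ((div_lt_one (by positivity)).2 (by linarith))
  have h1 : (1 - (K / (K + n) : ℝ))⁻¹ = 1 + K / n := by
    rw [one_sub_div (by positivity), add_sub_cancel_left, inv_div, add_comm, add_div,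
      div_self hn'.ne']
  have h2 : (K / (K + n) : ℝ) = (1 + (n : ℝ) / K)⁻¹ := by field_simp
  rw [h1, h2, inv_pow, ← div_eq_mul_inv, div_le_iff₀ (by positivity)] at h
  linarith

theorem one_add_div_pow_le_exp (a : ℝ) (ha : 0 ≤ a) (k : ℕ) (hk : 1 ≤ k) :
    (1 + a / k) ^ k ≤ Real.exp a := by
  have hk' : (0 : ℝ) < k := by exact_mod_cast hk
  calc (1 + a / k) ^ k ≤ Real.exp (a / k) ^ k := by
        refine pow_le_pow_left₀ (by positivity) ?_ k
        rw [add_comm]; exact Real.add_one_le_exp _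
    _ = Real.exp a := by rw [← Real.exp_nat_mul]; congr 1; field_simp

theorem card_multiIndex_le_pow_length (K n : ℕ) (hK : 1 ≤ K) (hn : 1 ≤ n) :
    (Fintype.card (MultiIndex K n) : ℝ) ≤ (Real.exp 1 * (1 + K / n)) ^ n := by
  refine (card_multiIndex_le K n hK hn).trans ?_
  rw [mul_pow, ← Real.exp_nat_mul, mul_one]
  gcongr
  exact one_add_div_pow_le_exp _ (by positivity) K hK

theorem card_multiIndex_le_pow_degree (K n : ℕ) (hK : 1 ≤ K) (hn : 1 ≤ n) :
    (Fintype.card (MultiIndex K n) : ℝ) ≤ (Real.exp 1 * (1 + n / K)) ^ K := by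
  refine (card_multiIndex_le K n hK hn).trans ?_
  rw [mul_pow, ← Real.exp_nat_mul, mul_one, mul_comm]
  gcongr
  exact one_add_div_pow_le_exp _ (by positivity) n hn

/-! ### Moments of sums with random signs -/

/-- The sign vectors `(±1)_{i ∈ Λ}`. -/
def signs (Λ : Type) [Fintype Λ] [DecidableEq Λ] : Finset (Λ → ℝ) :=
  Fintype.piFinset fun _ => {1, -1}

section

variable {Λ : Type} [Fintype Λ] [DecidableEq Λ]

theorem abs_eq_one_of_mem_signs {ε : Λ → ℝ} (hε : ε ∈ signs Λ) (i : Λ) : |ε i| = 1 := by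
  have := Fintype.mem_piFinset.1 hε i
  simp only [Finset.mem_insert, Finset.mem_singleton] at this
  rcases this with h | h <;> simp [h]

theorem card_signs : (signs Λ).card = 2 ^ Fintype.card Λ := by
  have h : ({1, -1} : Finset ℝ).card = 2 := Finset.card_pair (by norm_num)
  simp [signs, h]

theorem signs_nonempty : (signs Λ).Nonempty := by
  rw [← Finset.card_pos, card_signs]; positivity

theorem sum_signs_exp_le (a : Λ → ℝ) :
    ∑ ε ∈ signs Λ, Real.exp (∑ i, ε i * a i) ≤
      (signs Λ).card * Real.exp ((∑ i, a i ^ 2) / 2) := by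
  have h (i : Λ) : ∑ s ∈ ({1, -1} : Finset ℝ), Real.exp (s * a i) = 2 * Real.cosh (a i) := by
    rw [Finset.sum_pair (by norm_num), Real.cosh_eq]; ring_nf
  calc ∑ ε ∈ signs Λ, Real.exp (∑ i, ε i * a i)
      = ∏ i, (2 * Real.cosh (a i)) := by
        simp_rw [Real.exp_sum, ← h]
        rw [Finset.prod_univ_sum]; rfl
    _ = (signs Λ).card * ∏ i, Real.cosh (a i) := by
        rw [Finset.prod_mul_distrib, card_signs]; simp
    _ ≤ (signs Λ).card * ∏ i, Real.exp (a i ^ 2 / 2) := by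
        gcongr with i
        exact Real.cosh_le_exp_half_sq _
    _ = _ := by rw [← Real.exp_sum, Finset.sum_div]

theorem pow_two_mul_le_factorial_mul_cosh (x : ℝ) (k : ℕ) :
    x ^ (2 * k) ≤ (2 * k).factorial * Real.cosh x := by
  have h := le_hasSum (Real.hasSum_cosh x) k fun j _ => by
    rw [pow_mul]; positivity
  rwa [div_le_iff₀ (by positivity), mul_comm (Real.cosh x)] at h

/-- The moment is read off from the Laplace transform: x^{2k} is controlled by one term of the
series of cosh x, and the mean of cosh by the subgaussian estimate. -/
theorem sum_signs_pow_le (a : Λ → ℝ) {A : ℝ} (hA : 0 < A) (ha : ∑ i, a i ^ 2 ≤ A ^ 2)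
    {k : ℕ} (hk : 1 ≤ k) :
    ∑ ε ∈ signs Λ, (∑ i, ε i * a i) ^ (2 * k) ≤
      (signs Λ).card * (2 * Real.exp 1 * k * A ^ 2) ^ k := by
  have hk' : (0 : ℝ) < k := by exact_mod_cast hk
  -- Chosen so that l²A²/2 = k, which turns the subgaussian factor into e^k.
  set l : ℝ := √(2 * k) / A with hl
  have hl0 : 0 < l := by positivity
  have hl2 : l ^ 2 = 2 * k / A ^ 2 := by rw [hl, div_pow, Real.sq_sqrt (by positivity)]
  have hlA : l ^ 2 * A ^ 2 = 2 * k := by rw [hl2]; field_simp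
  have key (s : ℝ) (hs : s ^ 2 = 1) :
      ∑ ε ∈ signs Λ, Real.exp (s * (l * ∑ i, ε i * a i)) ≤ (signs Λ).card * Real.exp k := by
    have h := sum_signs_exp_le fun i => s * l * a i
    have h1 : ∑ i, (s * l * a i) ^ 2 = l ^ 2 * ∑ i, a i ^ 2 := by
      rw [Finset.mul_sum]
      exact Finset.sum_congr rfl fun i _ => by rw [mul_pow, mul_pow, hs, one_mul]
    have h2 : (∑ i, (s * l * a i) ^ 2) / 2 ≤ k := by
      rw [h1]
      nlinarith [mul_le_mul_of_nonneg_left ha (sq_nonneg l)]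
    refine le_trans (le_of_eq ?_) (h.trans (by gcongr))
    refine Finset.sum_congr rfl fun ε _ => ?_
    rw [Finset.mul_sum, Finset.mul_sum]
    exact congrArg _ (Finset.sum_congr rfl fun i _ => by ring)
  have hcosh : ∑ ε ∈ signs Λ, Real.cosh (l * ∑ i, ε i * a i) ≤ (signs Λ).card * Real.exp k := by
    simp_rw [Real.cosh_eq, ← Finset.sum_div, Finset.sum_add_distrib]
    have h1 := key 1 (by norm_num)
    have h2 := key (-1) (by norm_num)
    simp only [one_mul, neg_one_mul] at h1 h2
    linarith
  have hmain : (l ^ 2) ^ k * ∑ ε ∈ signs Λ, (∑ i, ε i * a i) ^ (2 * k) ≤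
      ((2 * k) ^ 2) ^ k * ((signs Λ).card * Real.exp k) := by
    calc (l ^ 2) ^ k * ∑ ε ∈ signs Λ, (∑ i, ε i * a i) ^ (2 * k)
        = ∑ ε ∈ signs Λ, (l * ∑ i, ε i * a i) ^ (2 * k) := by
          rw [Finset.mul_sum]
          exact Finset.sum_congr rfl fun ε _ => by rw [mul_pow, pow_mul l]
      _ ≤ ∑ ε ∈ signs Λ, (2 * k).factorial * Real.cosh (l * ∑ i, ε i * a i) :=
          Finset.sum_le_sum fun ε _ => pow_two_mul_le_factorial_mul_cosh _ _
      _ ≤ (2 * k).factorial * ((signs Λ).card * Real.exp k) := by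
          rw [← Finset.mul_sum]; gcongr
      _ ≤ _ := by
          gcongr
          rw [← pow_mul]
          exact_mod_cast Nat.factorial_le_pow (2 * k)
  have hfin : ((2 * k) ^ 2) ^ k * ((signs Λ).card * Real.exp k) =
      (l ^ 2) ^ k * ((signs Λ).card * (2 * Real.exp 1 * k * A ^ 2) ^ k) := by
    have : Real.exp k = Real.exp 1 ^ k := by rw [← Real.exp_nat_mul, mul_one]
    rw [this, mul_left_comm, mul_left_comm ((l ^ 2) ^ k), ← mul_pow, ← mul_pow,
      show l ^ 2 * (2 * Real.exp 1 * k * A ^ 2) = (2 * k) ^ 2 * Real.exp 1 by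
        linear_combination (2 * Real.exp 1 * k) * hlA]
  rw [hfin] at hmain
  exact le_of_mul_le_mul_left hmain (by positivity)

/-- Real and imaginary parts are treated separately; recombining them costs 2^(k-1) · 2 = 2^k,
whence 4e instead of 2e. -/
theorem sum_signs_norm_pow_le (a : Λ → ℂ) {A : ℝ} (hA : 0 < A) (ha : ∑ i, ‖a i‖ ^ 2 ≤ A ^ 2)
    {k : ℕ} (hk : 1 ≤ k) :
    ∑ ε ∈ signs Λ, ‖∑ i, (ε i : ℂ) * a i‖ ^ (2 * k) ≤
      (signs Λ).card * (4 * Real.exp 1 * k * A ^ 2) ^ k := by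
  have hre : ∑ i, (a i).re ^ 2 ≤ A ^ 2 := le_trans (Finset.sum_le_sum fun i _ => by
    rw [Complex.sq_norm, Complex.normSq_apply]; nlinarith [sq_nonneg (a i).im]) ha
  have him : ∑ i, (a i).im ^ 2 ≤ A ^ 2 := le_trans (Finset.sum_le_sum fun i _ => by
    rw [Complex.sq_norm, Complex.normSq_apply]; nlinarith [sq_nonneg (a i).re]) ha
  have h1 := sum_signs_pow_le _ hA hre hk
  have h2 := sum_signs_pow_le _ hA him hk
  have hle (ε : Λ → ℝ) : ‖∑ i, (ε i : ℂ) * a i‖ ^ (2 * k) ≤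
      2 ^ (k - 1) * ((∑ i, ε i * (a i).re) ^ (2 * k) + (∑ i, ε i * (a i).im) ^ (2 * k)) := by
    have : ‖∑ i, (ε i : ℂ) * a i‖ ^ 2 =
        (∑ i, ε i * (a i).re) ^ 2 + (∑ i, ε i * (a i).im) ^ 2 := by
      rw [Complex.sq_norm, Complex.normSq_apply, Complex.re_sum, Complex.im_sum]
      simp only [Complex.re_ofReal_mul, Complex.im_ofReal_mul]
      ring
    rw [pow_mul, pow_mul, pow_mul, this]
    exact add_pow_le (sq_nonneg _) (sq_nonneg _) k
  calc ∑ ε ∈ signs Λ, ‖∑ i, (ε i : ℂ) * a i‖ ^ (2 * k)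
      ≤ 2 ^ (k - 1) * (∑ ε ∈ signs Λ, (∑ i, ε i * (a i).re) ^ (2 * k) +
          ∑ ε ∈ signs Λ, (∑ i, ε i * (a i).im) ^ (2 * k)) := by
        rw [← Finset.sum_add_distrib, Finset.mul_sum]
        exact Finset.sum_le_sum fun ε _ => hle ε
    _ ≤ 2 ^ (k - 1) * (2 * ((signs Λ).card * (2 * Real.exp 1 * k * A ^ 2) ^ k)) := by
        gcongr; linarith
    _ = (2 ^ (k - 1) * 2) * (2 * Real.exp 1 * k * A ^ 2) ^ k * (signs Λ).card := by ring
    _ = _ := by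
        rw [← pow_succ, Nat.sub_add_cancel hk, ← mul_pow, mul_comm]
        ring_nf

end

/-! ### Polynomials on the torus -/

/-- The normalized Haar measure on the torus. -/
abbrev torusHaar (n : ℕ) : Measure (UnitAddTorus (Fin n)) :=
  Measure.pi fun _ : Fin n => (AddCircle.haarAddCircle : Measure UnitAddCircle)

theorem MultiIndex.toInt_injective {m n : ℕ} :
    Function.Injective (MultiIndex.toInt : MultiIndex m n → Fin n → ℤ) := by
  intro α β h
  ext j
  exact Int.ofNat_inj.1 (congrFun h j)

theorem mFourierCoeff_mFourier {n : ℕ} (k l : Fin n → ℤ) :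
    UnitAddTorus.mFourierCoeff (UnitAddTorus.mFourier l) k = if k = l then 1 else 0 := by
  have h := orthonormal_iff_ite.1 (UnitAddTorus.orthonormal_mFourier (d := Fin n)) k l
  rw [← h, ContinuousMap.inner_toLp]
  unfold UnitAddTorus.mFourierCoeff
  congr 1
  funext x
  rw [UnitAddTorus.mFourier_neg, smul_eq_mul, mul_comm]

/-- The Fourier coefficient as a linear functional on `C(𝕋ⁿ)`. -/
def coeffLinear {n : ℕ} (k : Fin n → ℤ) : C(UnitAddTorus (Fin n), ℂ) →ₗ[ℂ] ℂ where
  toFun f := UnitAddTorus.mFourierCoeff f k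
  map_add' := mFourierCoeff_add k
  map_smul' := mFourierCoeff_smul k

theorem mFourierCoeff_sum {m n : ℕ} (c : MultiIndex m n → ℂ) (α : MultiIndex m n) :
    UnitAddTorus.mFourierCoeff (⇑(∑ β, c β • UnitAddTorus.mFourier β.toInt :
      C(UnitAddTorus (Fin n), ℂ))) α.toInt = c α := by
  classical
  change coeffLinear α.toInt (∑ β, c β • UnitAddTorus.mFourier β.toInt) = c α
  rw [map_sum, Finset.sum_eq_single α]
  · rw [map_smul]
    change c α • UnitAddTorus.mFourierCoeff (UnitAddTorus.mFourier α.toInt) α.toInt = c α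
    rw [mFourierCoeff_mFourier, if_pos rfl, smul_eq_mul, mul_one]
  · intro β _ hβ
    rw [map_smul]
    change c β • UnitAddTorus.mFourierCoeff (UnitAddTorus.mFourier β.toInt) α.toInt = 0
    rw [mFourierCoeff_mFourier, if_neg fun h => hβ (MultiIndex.toInt_injective h).symm, smul_zero]
  · simp

theorem sum_norm_sq_mFourierCoeff_le {m n : ℕ} (f : C(UnitAddTorus (Fin n), ℂ)) :
    ∑ α : MultiIndex m n, ‖UnitAddTorus.mFourierCoeff f α.toInt‖ ^ 2 ≤
      ∫ x, ‖f x‖ ^ 2 ∂torusHaar n := by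
  classical
  have h := UnitAddTorus.hasSum_sq_mFourierCoeff (ContinuousMap.toLp 2 (torusHaar n) ℂ f)
  have hint : ∫ x, ‖ContinuousMap.toLp 2 (torusHaar n) ℂ f x‖ ^ 2 ∂torusHaar n =
      ∫ x, ‖f x‖ ^ 2 ∂torusHaar n := by
    refine integral_congr_ae ?_
    filter_upwards [ContinuousMap.coeFn_toLp (𝕜 := ℂ) (p := 2) (torusHaar n) f] with x hx
    rw [hx]
  have h' : HasSum (fun k => ‖UnitAddTorus.mFourierCoeff f k‖ ^ 2)
      (∫ x, ‖f x‖ ^ 2 ∂torusHaar n) := by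
    rw [← hint]
    refine h.congr_fun fun k => ?_
    rw [← UnitAddTorus.mFourierCoeff_toLp]
    rfl
  have := sum_le_hasSum (Finset.univ.map ⟨_, MultiIndex.toInt_injective (m := m) (n := n)⟩)
    (fun k _ => by positivity) h'
  rwa [Finset.sum_map] at this

/-- The supremum norm is at most the sum of the moduli of the coefficients; Cauchy–Schwarz and
Bessel do the rest. -/
theorem norm_sq_le_card_mul_integral {m n : ℕ} {f : C(UnitAddTorus (Fin n), ℂ)}
    (hf : f ∈ polySpace m n) :
    ‖f‖ ^ 2 ≤ Fintype.card (MultiIndex m n) * ∫ x, ‖f x‖ ^ 2 ∂torusHaar n := by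
  obtain ⟨c, rfl⟩ := (Submodule.mem_span_range_iff_exists_fun ℂ).1 hf
  set f : C(UnitAddTorus (Fin n), ℂ) := ∑ β, c β • UnitAddTorus.mFourier β.toInt with hfdef
  have h1 : ‖f‖ ≤ ∑ β, ‖c β‖ := by
    refine (norm_sum_le _ _).trans (Finset.sum_le_sum fun β _ => ?_)
    rw [norm_smul, UnitAddTorus.mFourier_norm, mul_one]
  have h2 : ∑ β, ‖c β‖ ^ 2 ≤ ∫ x, ‖f x‖ ^ 2 ∂torusHaar n := by
    refine le_trans (le_of_eq ?_) (sum_norm_sq_mFourierCoeff_le (m := m) f)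
    exact Finset.sum_congr rfl fun β _ => by rw [hfdef, mFourierCoeff_sum]
  calc ‖f‖ ^ 2 ≤ (∑ β, ‖c β‖) ^ 2 := by gcongr
    _ ≤ Fintype.card (MultiIndex m n) * ∑ β, ‖c β‖ ^ 2 := sq_sum_le_card_mul_sum_sq
    _ ≤ _ := by gcongr

theorem mFourier_mem_polySpace {m n : ℕ} (α : MultiIndex m n) :
    UnitAddTorus.mFourier α.toInt ∈ polySpace m n :=
  Submodule.subset_span ⟨α, rfl⟩

theorem mul_mem_polySpace {a b n : ℕ} {f g : C(UnitAddTorus (Fin n), ℂ)}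
    (hf : f ∈ polySpace a n) (hg : g ∈ polySpace b n) : f * g ∈ polySpace (a + b) n := by
  have h := Submodule.mul_mem_mul hf hg
  rw [polySpace, polySpace, Submodule.span_mul_span] at h
  refine Submodule.span_mono ?_ h
  rintro _ ⟨_, ⟨α, rfl⟩, _, ⟨β, rfl⟩, rfl⟩
  refine ⟨⟨α.1 + β.1, ?_⟩, ?_⟩
  · simpa [Finset.sum_add_distrib] using add_le_add α.2 β.2
  · ext x
    have : (MultiIndex.toInt ⟨α.1 + β.1, by
        simpa [Finset.sum_add_distrib] using add_le_add α.2 β.2⟩ : Fin n → ℤ) =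
        (α.toInt + β.toInt) := by
      funext j; simp [MultiIndex.toInt]
    simp only [ContinuousMap.mul_apply]
    rw [← UnitAddTorus.mFourier_add]
    exact congrArg (fun k => UnitAddTorus.mFourier k x) this

theorem pow_mem_polySpace {m n : ℕ} {f : C(UnitAddTorus (Fin n), ℂ)}
    (hf : f ∈ polySpace m n) (k : ℕ) : f ^ k ∈ polySpace (k * m) n := by
  induction k with
  | zero =>
    have h := mFourier_mem_polySpace (m := 0 * m) (n := n) ⟨0, by simp⟩
    have h0 : (MultiIndex.toInt (⟨0, by simp⟩ : MultiIndex (0 * m) n)) = 0 := by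
      funext j; simp [MultiIndex.toInt]
    rw [h0, UnitAddTorus.mFourier_zero] at h
    simpa using h
  | succ k ih =>
    rw [pow_succ, add_mul, one_mul]
    exact mul_mem_polySpace ih hf

/-- A Nikolskii inequality between the supremum norm and the `L_{2k}`-norm. -/
theorem norm_pow_le_card_mul_integral {m n : ℕ} {f : C(UnitAddTorus (Fin n), ℂ)}
    (hf : f ∈ polySpace m n) (k : ℕ) :
    ‖f‖ ^ (2 * k) ≤
      Fintype.card (MultiIndex (k * m) n) * ∫ x, ‖f x‖ ^ (2 * k) ∂torusHaar n := by
  -- Applying the L₂ estimate to f^k produces the L_{2k}-norm of f, at the price of raising the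
  -- degree to km.
  have h := norm_sq_le_card_mul_integral (pow_mem_polySpace hf k)
  have h1 : ‖f‖ ^ k ≤ ‖f ^ k‖ := by
    rcases Nat.eq_zero_or_pos k with rfl | hk
    · simp
    · obtain ⟨x, hx⟩ : ∃ x, ‖f x‖ = ‖f‖ := by
        obtain ⟨x, -, hx⟩ := isCompact_univ.exists_isMaxOn (Set.univ_nonempty)
          (f := fun x => ‖f x‖) (by fun_prop)
        refine ⟨x, le_antisymm (f.norm_coe_le_norm x) ?_⟩
        exact (ContinuousMap.norm_le _ (norm_nonneg _)).2 fun y => hx (Set.mem_univ y)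
      rw [← hx, ← norm_pow]
      exact (f ^ k).norm_coe_le_norm x
  calc ‖f‖ ^ (2 * k) = (‖f‖ ^ k) ^ 2 := by rw [← pow_mul, mul_comm]
    _ ≤ ‖f ^ k‖ ^ 2 := by gcongr
    _ ≤ _ := h
    _ = _ := by
        simp only [ContinuousMap.pow_apply, norm_pow, ← pow_mul, mul_comm]


/-! ### The Kahane–Salem–Zygmund inequality -/

/-- Some choice of signs does no worse than the average; after exchanging sum and integral, the
moment bound applies at each point, where monomials have modulus one. -/
theorem exists_signs_integral_le {m n : ℕ} (a : MultiIndex m n → ℂ) {A : ℝ} (hA : 0 < A)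
    (ha : ∑ α, ‖a α‖ ^ 2 ≤ A ^ 2) {k : ℕ} (hk : 1 ≤ k) :
    ∃ ε ∈ signs (MultiIndex m n),
      ∫ x, ‖(∑ α, ((ε α : ℂ) * a α) • UnitAddTorus.mFourier α.toInt :
        C(UnitAddTorus (Fin n), ℂ)) x‖ ^ (2 * k) ∂torusHaar n ≤
          (4 * Real.exp 1 * k * A ^ 2) ^ k := by
  refine Finset.exists_le_of_sum_le signs_nonempty ?_
  rw [← integral_finsetSum _ fun ε _ => ?_]
  · rw [Finset.sum_const, nsmul_eq_mul]
    refine (integral_mono_of_nonneg (.of_forall fun x => by positivity) (integrable_const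
      ((signs (MultiIndex m n)).card * (4 * Real.exp 1 * k * A ^ 2) ^ k))
      (.of_forall fun x => ?_)).trans (by simp)
    have hnorm (α : MultiIndex m n) : ‖UnitAddTorus.mFourier α.toInt x‖ = 1 := by
      simp only [UnitAddTorus.mFourier, ContinuousMap.coe_mk, norm_prod, fourier_apply,
        Circle.norm_coe, Finset.prod_const_one]
    have h := sum_signs_norm_pow_le (fun α => a α * UnitAddTorus.mFourier α.toInt x) hA
      (by simpa only [norm_mul, hnorm, mul_one] using ha) hk
    simpa only [ContinuousMap.sum_apply, ContinuousMap.smul_apply, smul_eq_mul, mul_assoc] using h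
  · exact Continuous.integrable_of_hasCompactSupport (by fun_prop)
      (HasCompactSupport.of_compactSpace _)

theorem one_le_log_one_add (m : ℕ) (hm : 1 ≤ m) : 1 ≤ Real.log (1 + 20 * m) := by
  have hm' : (1 : ℝ) ≤ m := by exact_mod_cast hm
  rw [Real.le_log_iff_exp_le (by positivity)]
  linarith [Real.exp_one_lt_d9]

theorem exists_signs_norm_le {m n : ℕ} (hm : 1 ≤ m) (hn : 1 ≤ n) (a : MultiIndex m n → ℂ) {A : ℝ}
    (hA : 0 < A) (ha : ∑ α, ‖a α‖ ^ 2 ≤ A ^ 2) :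
    ∃ ε ∈ signs (MultiIndex m n),
      ‖(∑ α, ((ε α : ℂ) * a α) • UnitAddTorus.mFourier α.toInt : C(UnitAddTorus (Fin n), ℂ))‖ ≤
        2 * √2 * Real.exp 1 ^ 2 * √n * √(Real.log (1 + 20 * m)) * A := by
  have hm' : (1 : ℝ) ≤ m := by exact_mod_cast hm
  have hn' : (0 : ℝ) < n := by exact_mod_cast hn
  set L := Real.log (1 + 20 * m) with hL
  have hL1 : 1 ≤ L := one_le_log_one_add m hm
  -- With k = nj, the space of polynomials of degree at most km has dimension at most e^{3k}, so
  -- passing from L_{2k} to the supremum norm costs only e^{3/2}.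
  set j := ⌈L⌉₊ with hj
  have hjL : L ≤ j := Nat.le_ceil L
  have hjL1 : (j : ℝ) < L + 1 := Nat.ceil_lt_add_one (by linarith)
  have hj1 : 1 ≤ j := by exact_mod_cast hL1.trans hjL
  have hLm : L ≤ 20 * m := by
    have := Real.log_le_sub_one_of_pos (show (0 : ℝ) < 1 + 20 * m by positivity)
    linarith
  have hexpL : Real.exp L = 1 + 20 * m := Real.exp_log (by positivity)
  obtain ⟨ε, hε, hint⟩ := exists_signs_integral_le a hA ha (k := n * j)
    (Nat.mul_pos hn hj1)
  refine ⟨ε, hε, ?_⟩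
  set f : C(UnitAddTorus (Fin n), ℂ) :=
    ∑ α, ((ε α : ℂ) * a α) • UnitAddTorus.mFourier α.toInt with hf
  have hfmem : f ∈ polySpace m n :=
    Submodule.sum_mem _ fun α _ => Submodule.smul_mem _ _ (mFourier_mem_polySpace α)
  have hcard : (Fintype.card (MultiIndex (n * j * m) n) : ℝ) ≤ (Real.exp 1 * (1 + j * m)) ^ n := by
    have h := card_multiIndex_le_pow_length (n * j * m) n
      (Nat.mul_pos (Nat.mul_pos hn hj1) hm) hn
    have h2 : ((n * j * m : ℕ) : ℝ) / n = j * m := by push_cast; field_simp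
    rwa [h2] at h
  have hcount : Real.exp 1 * (1 + j * m) ≤ (Real.exp 1 ^ 3) ^ j := by
    calc Real.exp 1 * (1 + j * m) ≤ Real.exp 1 * Real.exp L ^ 2 := by
          rw [hexpL]
          gcongr
          -- Here j ≤ 1 + 20m, hence 1 + jm ≤ (1 + 20m)².
          nlinarith
      _ = Real.exp (1 + 2 * L) := by rw [Real.exp_add, ← Real.exp_nat_mul]; norm_num
      _ ≤ Real.exp (3 * j) := Real.exp_le_exp.2 (by linarith)
      _ = (Real.exp 1 ^ 3) ^ j := by
          rw [← Real.exp_nat_mul, ← Real.exp_nat_mul]; congr 1; push_cast; ring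
  have hpow : (‖f‖ ^ 2) ^ (n * j) ≤
      (Real.exp 1 ^ 3 * (4 * Real.exp 1 * (n * j) * A ^ 2)) ^ (n * j) := by
    calc (‖f‖ ^ 2) ^ (n * j) = ‖f‖ ^ (2 * (n * j)) := by rw [← pow_mul]
      _ ≤ _ := norm_pow_le_card_mul_integral hfmem (n * j)
      _ ≤ (((Real.exp 1 ^ 3) ^ j) ^ n) * (4 * Real.exp 1 * (n * j : ℕ) * A ^ 2) ^ (n * j) := by
          gcongr
          exact hcard.trans (by gcongr)
      _ = _ := by
          rw [← pow_mul, mul_comm j n, ← mul_pow, Nat.cast_mul]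
  have hsq : ‖f‖ ^ 2 ≤ Real.exp 1 ^ 3 * (4 * Real.exp 1 * (n * j) * A ^ 2) :=
    (pow_le_pow_iff_left₀ (by positivity) (by positivity)
      (Nat.mul_pos hn hj1).ne').1 hpow
  refine (pow_le_pow_iff_left₀ (norm_nonneg _) (by positivity) two_ne_zero).1 (hsq.trans ?_)
  simp only [mul_pow]
  rw [Real.sq_sqrt (by norm_num), Real.sq_sqrt hn'.le, Real.sq_sqrt (by linarith)]
  calc Real.exp 1 ^ 3 * (4 * Real.exp 1 * (n * j) * A ^ 2)
      = 4 * Real.exp 1 ^ 4 * n * A ^ 2 * j := by ring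
    -- Rounding up at most doubles L because L ≥ 1.
    _ ≤ 4 * Real.exp 1 ^ 4 * n * A ^ 2 * (2 * L) := by gcongr; linarith
    _ = _ := by ring

/-! ### Diagonal operators -/

theorem PolySpace.norm_mk {m n : ℕ} (f : C(UnitAddTorus (Fin n), ℂ)) (hf : f ∈ polySpace m n) :
    ‖(show PolySpace m n from ⟨f, hf⟩)‖ = ‖f‖ := rfl

theorem sum_norm_mul_le_multiplier {m n : ℕ} (ξ c : MultiIndex m n → ℂ) :
    ∑ α, ‖ξ α * c α‖ ≤ ‖multiplier ξ‖ *
      ‖(∑ α, c α • UnitAddTorus.mFourier α.toInt : C(UnitAddTorus (Fin n), ℂ))‖ := by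
  set f : C(UnitAddTorus (Fin n), ℂ) := ∑ α, c α • UnitAddTorus.mFourier α.toInt with hf
  have hfmem : f ∈ polySpace m n :=
    Submodule.sum_mem _ fun α _ => Submodule.smul_mem _ _ (mFourier_mem_polySpace α)
  have h := (multiplier ξ).le_opNorm (show PolySpace m n from ⟨f, hfmem⟩)
  rw [PolySpace.norm_mk, PiLp.norm_eq_of_L1] at h
  refine le_trans (le_of_eq (Finset.sum_congr rfl fun α _ => ?_)) h
  rw [← mFourierCoeff_sum c α]
  rfl

theorem norm_le_norm_multiplier {m n : ℕ} (ξ : MultiIndex m n → ℂ) (α : MultiIndex m n) :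
    ‖ξ α‖ ≤ ‖multiplier ξ‖ := by
  classical
  have h := sum_norm_mul_le_multiplier ξ (Pi.single α 1)
  have h1 : (∑ β, (Pi.single α 1 : MultiIndex m n → ℂ) β • UnitAddTorus.mFourier β.toInt :
      C(UnitAddTorus (Fin n), ℂ)) = UnitAddTorus.mFourier α.toInt := by
    rw [Finset.sum_eq_single α (fun β _ hβ => by
      rw [Pi.single_eq_of_ne hβ]; exact zero_smul ℂ (UnitAddTorus.mFourier β.toInt)) (by simp),
      Pi.single_eq_same]
    exact one_smul ℂ (UnitAddTorus.mFourier α.toInt)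
  rw [h1, UnitAddTorus.mFourier_norm, mul_one] at h
  refine le_trans ?_ h
  simpa using Finset.single_le_sum (f := fun β => ‖ξ β * (Pi.single α 1 : MultiIndex m n → ℂ) β‖)
    (fun _ _ => norm_nonneg _) (Finset.mem_univ α)

theorem norm_diagonal_one_le {m n : ℕ} (hm : 1 ≤ m) (hn : 1 ≤ n) (ξ : MultiIndex m n → ℂ)
    (μ : EuclideanSpace ℂ (MultiIndex m n)) :
    ‖(WithLp.toLp 1 fun α => ξ α * μ α : PiLp 1 fun _ : MultiIndex m n => ℂ)‖ ≤
      2 * √2 * Real.exp 1 ^ 2 * √n * ‖multiplier ξ‖ * √(Real.log (1 + 20 * m)) * ‖μ‖ := by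
  rw [PiLp.norm_eq_of_L1]
  rcases eq_or_ne μ 0 with rfl | hμ
  · simp
  obtain ⟨ε, hε, h⟩ := exists_signs_norm_le hm hn (fun α => μ α) (norm_pos_iff.2 hμ)
    (EuclideanSpace.norm_sq_eq μ).ge
  calc ∑ α, ‖ξ α * μ α‖ = ∑ α, ‖ξ α * ((ε α : ℂ) * μ α)‖ := by
        refine Finset.sum_congr rfl fun α _ => ?_
        rw [norm_mul, norm_mul, norm_mul, Complex.norm_real, Real.norm_eq_abs,
          abs_eq_one_of_mem_signs hε, one_mul]
    _ ≤ _ := sum_norm_mul_le_multiplier ξ _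
    _ ≤ _ := mul_le_mul_of_nonneg_left h (norm_nonneg _)
    _ = _ := by ring

/-- This is the square of Hölder's inequality between ℓ₂ and ℓ_p with p = 2m/(m+1), since 2/p =
(m+1)/m and 2/p - 1 = 1/m. -/
theorem sum_rpow_le_card {Λ : Type} [Fintype Λ] (x : Λ → ℝ) (hx : ∀ i, 0 ≤ x i) {m : ℕ}
    (hm : 1 ≤ m) :
    (∑ i, x i ^ (2 * m / (m + 1) : ℝ)) ^ ((m + 1) / m : ℝ) ≤
      (Fintype.card Λ : ℝ) ^ (1 / m : ℝ) * ∑ i, x i ^ 2 := by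
  have hm' : (0 : ℝ) < m := by exact_mod_cast hm
  have h := Real.rpow_sum_le_const_mul_sum_rpow (Finset.univ : Finset Λ)
    (fun i => x i ^ (2 * m / (m + 1) : ℝ)) (p := (m + 1) / m)
    ((one_le_div hm').2 (by linarith))
  have h1 : (m + 1) / m - 1 = (1 / m : ℝ) := by field_simp; ring
  have h2 (i : Λ) : |x i ^ (2 * m / (m + 1) : ℝ)| = x i ^ (2 * m / (m + 1) : ℝ) :=
    abs_of_nonneg (Real.rpow_nonneg (hx i) _)
  have h3 (i : Λ) : (x i ^ (2 * m / (m + 1) : ℝ)) ^ ((m + 1) / m : ℝ) = x i ^ 2 := by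
    rw [← Real.rpow_mul (hx i), show (2 * m / (m + 1) : ℝ) * ((m + 1) / m) = (2 : ℕ) by
      push_cast; field_simp, Real.rpow_natCast]
  simpa only [h1, h2, h3, Finset.card_univ] using h

theorem norm_diagonal_bhExponent_le {m n : ℕ} (hm : 1 ≤ m) (hn : 1 ≤ n) (ξ : MultiIndex m n → ℂ)
    (μ : EuclideanSpace ℂ (MultiIndex m n)) [Fact (1 ≤ bhExponent m)] :
    ‖(WithLp.toLp (bhExponent m) fun α => ξ α * μ α :
        PiLp (bhExponent m) fun _ : MultiIndex m n => ℂ)‖ ≤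
      2 * √2 * Real.exp 1 ^ 2 * √n * ‖multiplier ξ‖ * ‖μ‖ := by
  have hm' : (1 : ℝ) ≤ m := by exact_mod_cast hm
  have hn' : (1 : ℝ) ≤ n := by exact_mod_cast hn
  have hp0 : (0 : ℝ) < 2 * m / (m + 1) := by positivity
  have hp : (bhExponent m).toReal = 2 * m / (m + 1) := ENNReal.toReal_ofReal hp0.le
  rw [PiLp.norm_eq_sum (by rw [hp]; exact hp0), hp]
  have hcard : (Fintype.card (MultiIndex m n) : ℝ) ^ (1 / m : ℝ) ≤ 2 * Real.exp 1 * n := by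
    calc (Fintype.card (MultiIndex m n) : ℝ) ^ (1 / m : ℝ)
        ≤ ((Real.exp 1 * (1 + n / m)) ^ m) ^ (1 / m : ℝ) :=
          Real.rpow_le_rpow (by positivity) (card_multiIndex_le_pow_degree m n hm hn)
            (by positivity)
      _ = Real.exp 1 * (1 + n / m) := by
          rw [one_div, Real.pow_rpow_inv_natCast (by positivity) (by omega)]
      _ ≤ Real.exp 1 * (n + n) := by
          gcongr
          exact div_le_self (by positivity) hm'
      _ = _ := by ring
  set S := ∑ α, ‖ξ α * μ α‖ ^ (2 * m / (m + 1) : ℝ) with hS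
  have hS0 : 0 ≤ S := by positivity
  have hsq : (S ^ (1 / (2 * m / (m + 1)) : ℝ)) ^ 2 ≤
      2 * Real.exp 1 * n * (‖multiplier ξ‖ ^ 2 * ‖μ‖ ^ 2) := by
    rw [← Real.rpow_natCast, ← Real.rpow_mul hS0,
      show (1 / (2 * m / (m + 1)) : ℝ) * (2 : ℕ) = (m + 1) / m by push_cast; field_simp]
    refine (sum_rpow_le_card (fun α => ‖ξ α * μ α‖) (fun α => norm_nonneg _) hm).trans ?_
    refine mul_le_mul hcard ?_ (by positivity) (by positivity)
    rw [EuclideanSpace.norm_sq_eq, Finset.mul_sum]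
    refine Finset.sum_le_sum fun α _ => ?_
    rw [norm_mul, mul_pow]
    gcongr
    exact norm_le_norm_multiplier ξ α
  refine (pow_le_pow_iff_left₀ (by positivity) (by positivity) two_ne_zero).1 (hsq.trans ?_)
  simp only [mul_pow]
  rw [Real.sq_sqrt (by norm_num), Real.sq_sqrt (by positivity)]
  have he : (1 : ℝ) ≤ Real.exp 1 := Real.one_le_exp zero_le_one
  calc 2 * Real.exp 1 * n * (‖multiplier ξ‖ ^ 2 * ‖μ‖ ^ 2)
      = (2 * Real.exp 1) * (n * ‖multiplier ξ‖ ^ 2 * ‖μ‖ ^ 2) := by ring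
    -- Deliberately wasteful: the constant is enlarged to the one of the ℓ₁ estimate, so that both
    -- endpoints share the same r.
    _ ≤ (8 * Real.exp 1 ^ 4) * (n * ‖multiplier ξ‖ ^ 2 * ‖μ‖ ^ 2) := by
        gcongr
        · norm_num
        · exact le_self_pow₀ he (by norm_num)
    _ = _ := by ring

/-! ### Orbits of the unit element -/

theorem subspace_ellp (Λ : Type) [Fintype Λ] (p : ℝ≥0∞) [Fact (1 ≤ p)] :
    (ellp Λ p).subspace = ⊤ :=
  LinearMap.range_eq_top.2 (PiLp.continuousLinearEquiv p ℂ (fun _ : Λ => ℂ)).surjective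

theorem mem_sum_ellCouple {m n : ℕ} (hm : 1 ≤ m) (v : (ellCouple m n hm).V) :
    v ∈ (ellCouple m n hm).sum := by
  have h : (ellCouple m n hm).sum = ⊤ := by
    rw [BanachCouple.sum, show (ellCouple m n hm).X₀.subspace = ⊤ from subspace_ellp _ _, top_sup_eq]
  rw [h]; trivial

/-- The operator `c ↦ c • v` from `(ℂ, ℂ)` into `(ℓ_1, ℓ_{2m/(m+1)})`. -/
def orbitHom {m n : ℕ} (hm : 1 ≤ m) (v : MultiIndex m n → ℂ) :
    CoupleHom scalarCouple (ellCouple m n hm) where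
  T := (LinearMap.toSpanSingleton ℂ (ellCouple m n hm).sum
      ⟨v, mem_sum_ellCouple hm v⟩).comp scalarCouple.sum.subtype
  T₀ := ContinuousLinearMap.toSpanSingleton ℂ
    (WithLp.toLp 1 v : PiLp 1 fun _ : MultiIndex m n => ℂ)
  T₁ :=
    haveI : Fact (1 ≤ bhExponent m) := ⟨one_le_bhExponent hm⟩
    ContinuousLinearMap.toSpanSingleton ℂ
      (WithLp.toLp (bhExponent m) v : PiLp (bhExponent m) fun _ : MultiIndex m n => ℂ)
  restrict₀ := by
    intro x w hw
    exact congrArg (fun c : ℂ => c • v) hw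
  restrict₁ := by
    intro x w hw
    exact congrArg (fun c : ℂ => c • v) hw

theorem BanachIn.nrm_le {V : Type} [AddCommGroup V] [Module ℂ V] [TopologicalSpace V]
    (Z : BanachIn V) (x : Z.E) : Z.nrm (Z.ι x) ≤ ‖x‖ₑ :=
  iInf₂_le (f := fun (y : Z.E) (_ : Z.ι y = Z.ι x) => ‖y‖ₑ) x rfl

theorem BanachIn.exists_of_nrm_le {V : Type} [AddCommGroup V] [Module ℂ V] [TopologicalSpace V]
    (Z : BanachIn V) {v : V} (hv : Z.nrm v ≤ 1) : ∃ x : Z.E, Z.ι x = v ∧ ‖x‖ ≤ 1 := by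
  by_cases h : ∃ x : Z.E, Z.ι x = v
  · obtain ⟨x, rfl⟩ := h
    refine ⟨x, rfl, ?_⟩
    have h1 : ‖x‖ₑ ≤ Z.nrm (Z.ι x) := le_iInf₂ fun y hy => by rw [Z.injective hy]
    have h2 := h1.trans hv
    rwa [← ofReal_norm, ENNReal.ofReal_le_one] at h2
  · have : Z.nrm v = ⊤ := by
      simp only [BanachIn.nrm, iInf_eq_top]
      exact fun x hx => absurd ⟨x, hx⟩ h
    rw [this] at hv
    exact absurd hv (by simp)

theorem norm_toSpanSingleton_inv_smul_le {E : Type} [NormedAddCommGroup E] [NormedSpace ℂ E]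
    {x : E} {r s : ℝ} (hr : 0 < r) (hx : ‖x‖ ≤ r * s) :
    ‖ContinuousLinearMap.toSpanSingleton ℂ ((r : ℂ)⁻¹ • x)‖ ≤ s := by
  rwa [ContinuousLinearMap.norm_toSpanSingleton, norm_smul, norm_inv, Complex.norm_real,
    Real.norm_of_nonneg hr.le, inv_mul_le_iff₀ hr]

namespace InterpolationFunctor

variable {F : InterpolationFunctor}

/-- Exactness bounds the set of norms by max(s, t); a real `sSup` dominates its members only if the
set is bounded above. -/
theorem norm_map_le_fundamentalFunction (hF : F.IsExact) {X Y : BanachCouple} (T : CoupleHom X Y)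
    {s t : ℝ} (h₀ : ‖T.T₀‖ ≤ s) (h₁ : ‖T.T₁‖ ≤ t) : ‖F.map T‖ ≤ F.fundamentalFunction s t := by
  refine le_csSup ⟨max s t, ?_⟩ ⟨X, Y, T, h₀, h₁, rfl⟩
  rintro _ ⟨X', Y', T', h₀', h₁', rfl⟩
  exact (hF X' Y' T').trans (max_le_max h₀' h₁')

/-- The identity of (ℂ, ℂ) induces the identity of 𝓕(ℂ, ℂ), a space that is nonzero because it
contains 1. -/
theorem one_le_fundamentalFunction (hF : F.IsExact) (hnorm : F.IsNormalized) :
    1 ≤ F.fundamentalFunction 1 1 := by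
  obtain ⟨x, hx, -⟩ := (F.obj scalarCouple).exists_of_nrm_le hnorm
  let T : CoupleHom scalarCouple scalarCouple :=
    { T := LinearMap.id
      T₀ := ContinuousLinearMap.id ℂ _
      T₁ := ContinuousLinearMap.id ℂ _
      restrict₀ := fun _ _ h => h
      restrict₁ := fun _ _ h => h }
  have hxs : (F.obj scalarCouple).ι x ∈ scalarCouple.sum :=
    F.le_sum scalarCouple ⟨x, rfl⟩
  have hTx : F.map T x = x :=
    (F.obj scalarCouple).injective (F.map_spec T x ⟨_, hxs⟩ rfl).symm
  have hx0 : 0 < ‖x‖ := by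
    refine norm_pos_iff.2 fun h => ?_
    rw [h, map_zero] at hx
    exact zero_ne_one (α := ℂ) hx
  have h1 : 1 ≤ ‖F.map T‖ := by
    have := (F.map T).le_opNorm x
    rw [hTx] at this
    exact le_of_mul_le_mul_right (by rwa [one_mul]) hx0
  exact h1.trans (norm_map_le_fundamentalFunction hF T ContinuousLinearMap.norm_id_le
    ContinuousLinearMap.norm_id_le)

theorem nrm_le_of_norm_le (hF : F.IsExact) (hnorm : F.IsNormalized) {m n : ℕ} (hm : 1 ≤ m)
    [Fact (1 ≤ bhExponent m)] (v : MultiIndex m n → ℂ) {r s t : ℝ} (hr : 0 ≤ r)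
    (h₀ : ‖(WithLp.toLp 1 v : PiLp 1 fun _ : MultiIndex m n => ℂ)‖ ≤ r * s)
    (h₁ : ‖(WithLp.toLp (bhExponent m) v :
      PiLp (bhExponent m) fun _ : MultiIndex m n => ℂ)‖ ≤ r * t) :
    (F.obj (ellCouple m n hm)).nrm v ≤ ENNReal.ofReal (r * F.fundamentalFunction s t) := by
  -- The rank-one operator involves division by r, so r = 0 is separate; there the ℓ₁ bound forces v
  -- = 0.
  rcases hr.eq_or_lt with rfl | hr
  · have hv : v = 0 := by
      rw [zero_mul] at h₀
      exact congrArg WithLp.ofLp (norm_le_zero_iff.1 h₀)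
    have h := (F.obj (ellCouple m n hm)).nrm_le 0
    rw [map_zero, enorm_zero] at h
    rw [hv]
    exact h.trans zero_le
  obtain ⟨x, hx, hx1⟩ := (F.obj scalarCouple).exists_of_nrm_le hnorm
  set T := orbitHom hm ((r⁻¹ : ℂ) • v) with hT
  have hT₀ : ‖T.T₀‖ ≤ s := norm_toSpanSingleton_inv_smul_le hr h₀
  have hT₁ : ‖T.T₁‖ ≤ t := norm_toSpanSingleton_inv_smul_le hr h₁
  have hxs : (F.obj scalarCouple).ι x ∈ scalarCouple.sum := F.le_sum scalarCouple ⟨x, rfl⟩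
  have hmap : (F.obj (ellCouple m n hm)).ι ((r : ℂ) • F.map T x) = v := by
    rw [map_smul, ← F.map_spec T x ⟨_, hxs⟩ rfl]
    have hr' : (r : ℂ) ≠ 0 := by exact_mod_cast hr.ne'
    refine (congrArg (fun c : ℂ => (r : ℂ) • c • (r⁻¹ : ℂ) • v) hx).trans ?_
    simp only [one_smul, smul_inv_smul₀ hr']
  rw [← hmap]
  refine ((F.obj (ellCouple m n hm)).nrm_le _).trans ?_
  rw [← ofReal_norm]
  refine ENNReal.ofReal_le_ofReal ?_
  rw [norm_smul, Complex.norm_real, Real.norm_of_nonneg hr.le]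
  gcongr
  exact ((F.map T).unit_le_opNorm x hx1).trans (norm_map_le_fundamentalFunction hF T hT₀ hT₁)

end InterpolationFunctor

end KislyakovInterpolation

end

theorem mainTheorem8 (F : KislyakovInterpolation.InterpolationFunctor) (hF : F.IsExact)
    (hnorm : F.IsNormalized) (m n : ℕ) (hm : 1 ≤ m) (hn : 1 ≤ n)
    (ξ : KislyakovInterpolation.MultiIndex m n → ℂ) :
    (⨆ (μ : EuclideanSpace ℂ (KislyakovInterpolation.MultiIndex m n)) (_ : ‖μ‖ ≤ 1),
        (F.obj (KislyakovInterpolation.ellCouple m n hm)).nrm (fun α => ξ α * μ α)) ≤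
      ENNReal.ofReal
        ((2 * √2 * Real.exp 1 ^ 2 * F.fundamentalFunction 1 1 *
            F.fundamentalFunction (√(Real.log (1 + 20 * m))) 1) *
          √n * ‖KislyakovInterpolation.multiplier ξ‖) := by
  have : Fact (1 ≤ KislyakovInterpolation.bhExponent m) :=
    ⟨KislyakovInterpolation.one_le_bhExponent hm⟩
  refine iSup₂_le fun μ hμ => ?_
  set r : ℝ := 2 * √2 * Real.exp 1 ^ 2 * √n * ‖KislyakovInterpolation.multiplier ξ‖ with hr
  have hr0 : 0 ≤ r := by positivity
  set ψ := F.fundamentalFunction (√(Real.log (1 + 20 * m))) 1 with hψ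
  have hψ0 : 0 ≤ ψ := by
    refine Real.sSup_nonneg ?_
    rintro _ ⟨X, Y, T, -, -, rfl⟩
    exact norm_nonneg _
  refine (KislyakovInterpolation.InterpolationFunctor.nrm_le_of_norm_le hF hnorm hm
    (fun α => ξ α * μ α) hr0
    (((KislyakovInterpolation.norm_diagonal_one_le hm hn ξ μ)).trans
      (mul_le_of_le_one_right (by positivity) hμ))
    ((KislyakovInterpolation.norm_diagonal_bhExponent_le hm hn ξ μ).trans
      (mul_le_mul_of_nonneg_left hμ hr0))).trans (ENNReal.ofReal_le_ofReal ?_)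
  -- The estimate already holds without the factor ψ(1,1); inserting it is harmless since ψ(1,1) ≥
  -- 1.
  calc r * ψ ≤ F.fundamentalFunction 1 1 * (r * ψ) :=
        le_mul_of_one_le_left (mul_nonneg hr0 hψ0)
          (KislyakovInterpolation.InterpolationFunctor.one_le_fundamentalFunction hF hnorm)
    _ = _ := by rw [hr]; ring
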